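/- Let $P\subset\mathbb R^m$ be a nonempty polytope (the convex hull of a nonempty finite set), of dimension $d$, and let $\mathcal F(P)$ be the set of its nonempty faces, including $P$ itself. Let $\partial P$ be the union of the faces of $P$ other than $P$. Fix a choice of apexes $V(P)$: to every $F\in\mathcal F(P)$ a vertex $\mathbf v_F$ of $F$ is assigned, such that whenever $F_1,F_2\in\mathcal F(P)$ and $\mathbf v_{F_1},\mathbf v_{F_2}\in F_1\cap F_2$, then $\mathbf v_{F_1}=\mathbf v_{F_2}$ (for example, $\mathbf v_F$ is the point of $F$ minimizing a fixed linear function that takes distinct values at distinct vertices of $P$). The $V(P)$-polytope numbers $F(n)$ and the interior polytope numbers $F(n)^\sharp$ of the faces $F\in\mathcal F(P)$ ($n\ge 0$) are defined by double induction on $\dim F$ and $n$. If $\dim F=0$, then $F(0)=F(0)^\sharp=0$ and $F(n)=F(n)^\sharp=1$ for $n\ge 1$. If $\dim F\ge 1$, then $F(0)=0$, $F(1)=1$, $F(0)^\sharp=F(1)^\sharp=0$ and, for $n\ge 2$, $$F(n)=F(n-1)+\sum_{G\in\mathcal F(F),\ \mathbf v_F\notin G}G(n)^\sharp,\qquad F(n)^\sharp=F(n)-\sum_{G\in\mathcal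 F(F)\setminus\{F\}}G(n)^\sharp .$$ Theorem (vertex description of polytope numbers). We have $P(0)=P(0)^\sharp=0$ and $P(1)=1$, while $P(1)^\sharp=1$ if $d=0$ and $P(1)^\sharp=0$ if $d\ge 1$. For every $n\ge 2$, the set of sums in the first formula below is finite, and $$P(n)=\Big|\Big\{\sum_{i=1}^{n-1}\mathbf v_{F_i}\ \Big|\ F_1,\dots,F_{n-1}\in\mathcal F(P),\ F_1\supseteq F_2\supseteq\cdots\supseteq F_{n-1}\Big\}\Big|,$$ $$P(n)^\sharp=\Big|\Big\{\sum_{i=1}^{n-1}\mathbf v_{F_i}\ \Big|\ F_1,\dots,F_{n-1}\in\mathcal F(P),\ F_1\supseteq\cdots\supseteq F_{n-1},\ \operatorname{conv}\{\mathbf v_{F_1},\dots,\mathbf v_{F_{n-1}}\}\not\subseteq\partial P\Big\}\Big|.$$ -/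

import Mathlib

namespace PolytopeNumbers

variable {E : Type*} [NormedAddCommGroup E] [NormedSpace ℝ E]

/-- A (nonempty) polytope: the convex hull of a nonempty finite set of points. -/
def IsPolytope (P : Set E) : Prop :=
  ∃ s : Finset E, s.Nonempty ∧ P = convexHull ℝ (s : Set E)

/-- The nonempty faces of `P`, including `P` itself: the nonempty subsets of `P` on which some
linear form attains its maximum over `P`. -/
def faces (P : Set E) : Set (Set E) :=
  {F | F.Nonempty ∧ IsExposed ℝ P F}

/-- The nonempty faces of `P` other than `P` itself. -/
def properFaces (P : Set E) : Set (Set E) :=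
  {F | F ∈ faces P ∧ F ≠ P}

/-- The boundary of `P`: the points of `P` that lie in some proper face. -/
def boundary (P : Set E) : Set E :=
  {y | y ∈ P ∧ ∃ F ∈ properFaces P, y ∈ F}

/-- The dimension of `P`, that is, the dimension of its affine hull. -/
noncomputable def dim (P : Set E) : ℕ :=
  Module.finrank ℝ (vectorSpan ℝ P)

/-- An apex assignment for `P`: every nonempty face `F` has a designated vertex `v F` of `F`
(a vertex is a point that is by itself a face), and two faces whose apexes both lie in their
intersection have the same apex. -/
structure IsApexAssignment (P : Set E) (v : Set E → E) : Prop where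
  vertex : ∀ F ∈ faces P, v F ∈ F.exposedPoints ℝ
  consistent : ∀ F₁ ∈ faces P, ∀ F₂ ∈ faces P,
    v F₁ ∈ F₁ ∩ F₂ → v F₂ ∈ F₁ ∩ F₂ → v F₁ = v F₂

/-- A linear form in general position, that is, one with a unique minimum point on each face,
gives an apex assignment. -/
theorem IsApexAssignment.of_linear {P : Set E} {v : Set E → E} (l : E →L[ℝ] ℝ)
    (h : ∀ F ∈ faces P, v F ∈ F ∧ ∀ y ∈ F, y ≠ v F → l (v F) < l y) :
    IsApexAssignment P v where
  vertex F hF := by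
    refine ⟨(h F hF).1, -l, fun y hy => ?_⟩
    by_cases hyv : y = v F
    · subst hyv; simp
    · have := (h F hF).2 y hy hyv
      refine ⟨by simpa using this.le, fun h' => ?_⟩
      simp at h'
      linarith
  consistent F₁ h₁ F₂ h₂ hv₁ hv₂ := by
    by_contra hne
    have a := (h F₁ h₁).2 _ hv₂.1 (Ne.symm hne)
    have b := (h F₂ h₂).2 _ hv₁.2 hne
    linarith

/-- A polytope has finitely many faces, so the sums over faces below are finite sums. -/
theorem IsPolytope.finite_faces {P : Set E} (hP : IsPolytope P) : (faces P).Finite := by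
  obtain ⟨s, -, rfl⟩ := hP
  have key : ∀ F ∈ faces (convexHull ℝ (s : Set E)), F = convexHull ℝ ((s : Set E) ∩ F) := by
    rintro F ⟨hne, hF⟩
    have hcv : Convex ℝ F := hF.convex (convex_convexHull ℝ _)
    apply Set.Subset.antisymm
    · intro x hx
      obtain ⟨l, hl⟩ := hF hne
      have hx' := hx
      rw [hl] at hx'
      obtain ⟨hxP, hmax⟩ := hx'
      rw [Finset.mem_convexHull'] at hxP
      obtain ⟨w, hw0, hw1, hwx⟩ := hxP
      have hle : ∀ y ∈ s, l y ≤ l x := fun y hy => hmax y (subset_convexHull ℝ _ hy)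
      have hsum : ∑ y ∈ s, w y * (l x - l y) = 0 := by
        have : l x = ∑ y ∈ s, w y * l y := by
          conv_lhs => rw [← hwx]
          simp [map_sum]
        simp only [mul_sub, Finset.sum_sub_distrib, ← Finset.sum_mul, hw1]
        linarith
      have hz := (Finset.sum_eq_zero_iff_of_nonneg
        (fun y hy => mul_nonneg (hw0 y hy) (sub_nonneg.2 (hle y hy)))).1 hsum
      have hmem : ∀ y ∈ s, w y ≠ 0 → y ∈ (s : Set E) ∩ F := by
        intro y hy hwy
        refine ⟨hy, ?_⟩
        have h0 : l x - l y = 0 := (mul_eq_zero.1 (hz y hy)).resolve_left hwy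
        rw [hl]
        exact ⟨subset_convexHull ℝ _ hy, fun z hz => (hmax z hz).trans (by linarith)⟩
      rw [← hwx]
      classical
      rw [← Finset.sum_filter_of_ne (p := fun y => w y ≠ 0)
        (fun y _ h h0 => h (by simp [h0]))]
      refine (convex_convexHull ℝ _).sum_mem (fun y hy => hw0 y (Finset.mem_filter.1 hy).1) ?_ ?_
      · rw [Finset.sum_filter_ne_zero, hw1]
      · intro y hy
        exact subset_convexHull ℝ _ (hmem y (Finset.mem_filter.1 hy).1 (Finset.mem_filter.1 hy).2)
    · exact convexHull_min Set.inter_subset_right hcv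
  refine ((s.finite_toSet.finite_subsets).image (convexHull ℝ)).subset ?_
  intro F hF
  exact ⟨(s : Set E) ∩ F, Set.inter_subset_left, (key F hF).symm⟩

/-- A proper face has smaller dimension; this is what the recursion below runs on. -/
theorem dim_lt_of_mem_properFaces [FiniteDimensional ℝ E] {P F : Set E} (hF : F ∈ properFaces P) : dim F < dim P := by
  obtain ⟨⟨⟨p, hp⟩, hE⟩, hne⟩ := hF
  obtain ⟨l, hl⟩ := hE ⟨p, hp⟩
  have hsub : F ⊆ P := hE.subset
  obtain ⟨q, hqP, hqF⟩ : ∃ q ∈ P, q ∉ F := by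
    by_contra! h
    exact hne (Set.Subset.antisymm hsub h)
  have hpmax : ∀ y ∈ P, l y ≤ l p := by
    have := hp
    rw [hl] at this
    exact this.2
  have hlt : l q ≠ l p := by
    intro h
    apply hqF
    rw [hl]
    exact ⟨hqP, fun y hy => h ▸ hpmax y hy⟩
  have hker : vectorSpan ℝ F ≤ LinearMap.ker (l : E →ₗ[ℝ] ℝ) := by
    rw [vectorSpan_def, Submodule.span_le]
    rintro _ ⟨a, ha, b, hb, rfl⟩
    have ha' := ha
    have hb' := hb
    rw [hl] at ha' hb'
    have h1 := ha'.2 b hb'.1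
    have h2 := hb'.2 a ha'.1
    simp
    linarith
  apply Submodule.finrank_lt_finrank_of_lt
  refine lt_of_le_of_ne (vectorSpan_mono ℝ hsub) fun heq => hlt ?_
  have hm : q -ᵥ p ∈ vectorSpan ℝ F := heq ▸ vsub_mem_vectorSpan ℝ hqP (hsub hp)
  have := hker hm
  simp at this
  linarith

mutual

/-- The polytope numbers `P(n)` with respect to the apexes `v`: for a point they are
`0, 1, 1, 1, …`; in positive dimension `P(0) = 0`, `P(1) = 1`, and for `n ≥ 2` the number `P(n)`
is `P(n-1)` plus the sum of `F(n)^♯` over the faces `F` that do not contain the apex of `P`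
(such a face is automatically different from `P`). -/
noncomputable def polytopeNumber [FiniteDimensional ℝ E] (v : Set E → E) (P : Set E)
    (n : ℕ) : ℤ :=
  match n with
  | 0 => 0
  | 1 => 1
  | n + 2 =>
    if dim P = 0 then 1
    else polytopeNumber v P (n + 1) +
      ∑ᶠ F : {F : Set E // F ∈ properFaces P ∧ v P ∉ F}, interiorPolytopeNumber v F.1 (n + 2)
termination_by (dim P, n, 0)
decreasing_by
  · exact Prod.Lex.right _ (Prod.Lex.left _ _ (by omega))
  · exact Prod.Lex.left _ _ (dim_lt_of_mem_properFaces F.2.1)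

/-- The interior polytope numbers `P(n)^♯` with respect to the apexes `v`: for a point they are
`0, 1, 1, 1, …`; in positive dimension `P(0)^♯ = P(1)^♯ = 0`, and for `n ≥ 2` the number `P(n)^♯`
is `P(n)` minus the sum of `F(n)^♯` over the proper faces `F`. -/
noncomputable def interiorPolytopeNumber [FiniteDimensional ℝ E] (v : Set E → E) (P : Set E)
    (n : ℕ) : ℤ :=
  match n with
  | 0 => 0
  | 1 => if dim P = 0 then 1 else 0
  | n + 2 =>
    if dim P = 0 then 1
    else polytopeNumber v P (n + 2) -
      ∑ᶠ F : {F : Set E // F ∈ properFaces P}, interiorPolytopeNumber v F.1 (n + 2)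
termination_by (dim P, n, 1)
decreasing_by
  · exact Prod.Lex.right _ (Prod.Lex.right _ (by omega))
  · exact Prod.Lex.left _ _ (dim_lt_of_mem_properFaces F.2)

end

/-- The sums `v_{F_1} + ⋯ + v_{F_k}` over weakly decreasing chains `F_1 ⊇ ⋯ ⊇ F_k` of nonempty
faces of `P`. -/
def chainSums (v : Set E → E) (P : Set E) (k : ℕ) : Set E :=
  {x | ∃ F : Fin k → Set E, (∀ i, F i ∈ faces P) ∧ Antitone F ∧ x = ∑ i, v (F i)}

/-- The sums `v_{F_1} + ⋯ + v_{F_k}` over those weakly decreasing chains `F_1 ⊇ ⋯ ⊇ F_k` of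
nonempty faces of `P` for which the convex hull of the apexes is not contained in the boundary
of `P`. -/
def interiorChainSums (v : Set E → E) (P : Set E) (k : ℕ) : Set E :=
  {x | ∃ F : Fin k → Set E, (∀ i, F i ∈ faces P) ∧ Antitone F ∧
    ¬ convexHull ℝ (Set.range fun i => v (F i)) ⊆ boundary P ∧ x = ∑ i, v (F i)}

end PolytopeNumbers

/-
The mean `(n - 1)⁻¹ • ∑ v_{F_i}` of the apexes of a chain lies in the relative interior of exactly
one face `F` of `P`, and `F` contains all the `v_{F_i}`. Intersecting the chain with `F` does not
move its apexes, so the interior chain sums of `F` are precisely the chain sums of `P` with mean in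
the relative interior of `F`. Hence the chain sums of `P` are the disjoint union, over all faces
`F`, of the interior chain sums of `F`; this is the recursion for `P(n)^♯`. Moreover `F ⊆ F_1`, so
if `v_P ∈ F` then `v_{F_1} = v_P`: the chain sums with `v_P ∈ F` are the translates by `v_P` of the
chain sums of length one less, which is the recursion for `P(n)`.
-/

namespace PolytopeNumbers

section Exposed

variable {𝕜 E : Type*} [TopologicalSpace 𝕜] [AddCommMonoid E] [TopologicalSpace E]

theorem isExposed_sep_eq_of_forall_le [Semiring 𝕜] [PartialOrder 𝕜] [Module 𝕜 E] {A : Set E}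
    {l : StrongDual 𝕜 E} {c : 𝕜} (hl : ∀ y ∈ A, l y ≤ c) :
    IsExposed 𝕜 A {y ∈ A | l y = c} := by
  rintro ⟨b, hbA, rfl⟩
  refine ⟨l, Set.ext fun y => and_congr_right fun hy => ?_⟩
  exact ⟨fun heq z hz => heq ▸ hl z hz, fun hmax => (hl y hy).antisymm (hmax b hbA)⟩

theorem exists_eq_sep_eq_of_isExposed [Semiring 𝕜] [PartialOrder 𝕜] [Module 𝕜 E] {A B : Set E}
    (hAB : IsExposed 𝕜 A B) (hB : B.Nonempty) :
    ∃ (l : StrongDual 𝕜 E) (c : 𝕜), (∀ y ∈ A, l y ≤ c) ∧ B = {y ∈ A | l y = c} := by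
  obtain ⟨b, hb⟩ := hB
  obtain ⟨l, rfl⟩ := hAB ⟨b, hb⟩
  refine ⟨l, l b, hb.2, Set.ext fun y => and_congr_right fun hy => ?_⟩
  exact ⟨fun hmax => (hb.2 y hy).antisymm (hmax b hb.1), fun heq z hz => heq ▸ hb.2 z hz⟩

theorem mem_of_sum_smul_mem [CommRing 𝕜] [LinearOrder 𝕜] [IsStrictOrderedRing 𝕜] [Module 𝕜 E]
    {A B : Set E} (hB : IsExposed 𝕜 A B) {ι : Type*} {t : Finset ι} {w : ι → 𝕜} {x : ι → E}
    (hw₀ : ∀ i ∈ t, 0 ≤ w i) (hw₁ : ∑ i ∈ t, w i = 1) (hx : ∀ i ∈ t, x i ∈ A)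
    (hsum : ∑ i ∈ t, w i • x i ∈ B) {i : ι} (hi : i ∈ t) (hwi : 0 < w i) : x i ∈ B := by
  obtain ⟨l, c, hle, rfl⟩ := exists_eq_sep_eq_of_isExposed hB ⟨_, hsum⟩
  refine ⟨hx i hi, (hle _ (hx i hi)).eq_of_not_lt fun hlt => hsum.2.not_lt ?_⟩
  calc l (∑ j ∈ t, w j • x j)
    _ = ∑ j ∈ t, w j * l (x j) := by simp only [map_sum, map_smul, smul_eq_mul]
    _ < ∑ j ∈ t, w j * c := Finset.sum_lt_sum
        (fun j hj => mul_le_mul_of_nonneg_left (hle _ (hx j hj)) (hw₀ j hj))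
        ⟨i, hi, mul_lt_mul_of_pos_left hlt hwi⟩
    _ = c := by rw [← Finset.sum_mul, hw₁, one_mul]

end Exposed

section ConvexHull

theorem exists_forall_lt_mul {ι 𝕜 : Type*} [Field 𝕜] [LinearOrder 𝕜] [IsStrictOrderedRing 𝕜]
    {t : Set ι} (ht : t.Finite) {a : ι → 𝕜} (ha : ∀ i ∈ t, 0 < a i) (b : ι → 𝕜) :
    ∃ N, ∀ i ∈ t, b i < N * a i := by
  obtain ⟨M, hM⟩ := (ht.image fun i => b i / a i).bddAbove
  obtain ⟨N, hMN⟩ := exists_gt M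
  exact ⟨N, fun i hi => (div_lt_iff₀ (ha i hi)).1 ((hM (Set.mem_image_of_mem _ hi)).trans_lt hMN)⟩

variable {𝕜 E : Type*} [Field 𝕜] [LinearOrder 𝕜] [IsStrictOrderedRing 𝕜] [AddCommGroup E]
  [Module 𝕜 E] {s A B : Set E}

theorem sum_smul_mem_iff [TopologicalSpace 𝕜] [TopologicalSpace E] (hA : Convex 𝕜 A)
    (hB : IsExposed 𝕜 A B) {ι : Type*} [Fintype ι] {w : ι → 𝕜} (hw₀ : ∀ i, 0 < w i)
    (hw₁ : ∑ i, w i = 1) {x : ι → E} (hx : ∀ i, x i ∈ A) :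
    ∑ i, w i • x i ∈ B ↔ ∀ i, x i ∈ B :=
  ⟨fun h i => mem_of_sum_smul_mem hB (fun j _ => (hw₀ j).le) hw₁ (fun j _ => hx j) h
    (Finset.mem_univ i) (hw₀ i),
  fun h => (hB.convex hA).sum_mem (fun j _ => (hw₀ j).le) hw₁ fun j _ => h j⟩

theorem eq_convexHull_inter_of_isExtreme (hB : IsExtreme 𝕜 (convexHull 𝕜 s) B)
    (hBconv : Convex 𝕜 B) : B = convexHull 𝕜 (s ∩ B) := by
  refine Set.Subset.antisymm (fun x hx => ?_) (convexHull_min Set.inter_subset_right hBconv)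
  have hdiff : convexHull 𝕜 (s \ B) ⊆ convexHull 𝕜 s \ B :=
    convexHull_min (Set.sdiff_subset_sdiff_left (subset_convexHull 𝕜 s))
      (hB.convex_sdiff (convex_convexHull 𝕜 s))
  have hxs : x ∈ convexHull 𝕜 (s ∩ B ∪ s \ B) := by
    rw [Set.inter_union_sdiff]
    exact hB.subset hx
  obtain hin | hin := (s ∩ B).eq_empty_or_nonempty
  · rw [hin, Set.empty_union] at hxs
    exact absurd hx (hdiff hxs).2
  obtain hout | hout := (s \ B).eq_empty_or_nonempty
  · rwa [hout, Set.union_empty] at hxs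
  rw [convexHull_union hin hout, mem_convexJoin] at hxs
  obtain ⟨p, hp, q, hq, hxpq⟩ := hxs
  by_contra hxin
  have hopen : x ∈ openSegment 𝕜 p q :=
    mem_openSegment_of_ne_left_right (ne_of_mem_of_not_mem hp hxin)
      (ne_of_mem_of_not_mem hx (hdiff hq).2).symm hxpq
  exact (hdiff hq).2 (hB.right_mem_of_mem_openSegment
    (convexHull_mono Set.inter_subset_left hp) (hdiff hq).1 hx hopen)

theorem isExposed_trans_of_finite [TopologicalSpace 𝕜] [IsTopologicalRing 𝕜] [TopologicalSpace E]
    (hs : s.Finite) (hA : IsExposed 𝕜 (convexHull 𝕜 s) A) (hB : IsExposed 𝕜 A B) :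
    IsExposed 𝕜 (convexHull 𝕜 s) B := by
  obtain rfl | hBne := B.eq_empty_or_nonempty
  · exact isExposed_empty
  have hBconv : Convex 𝕜 B := hB.convex (hA.convex (convex_convexHull 𝕜 s))
  obtain ⟨l₁, c₁, hl₁, rfl⟩ := exists_eq_sep_eq_of_isExposed hA (hBne.mono hB.subset)
  obtain ⟨l₂, c₂, hl₂, rfl⟩ := exists_eq_sep_eq_of_isExposed hB hBne
  obtain ⟨N, hN⟩ := exists_forall_lt_mul (hs.subset (Set.sep_subset s fun y => l₁ y < c₁))
    (fun y hy => sub_pos.2 hy.2) fun y => l₂ y - c₂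
  -- On `s`, the form `N • l₁ + l₂` is governed by `l₁` first and by `l₂` where `l₁` is maximal.
  have hgen : ∀ y ∈ s, (N • l₁ + l₂) y ≤ N * c₁ + c₂ ∧
      ((N • l₁ + l₂) y = N * c₁ + c₂ → l₁ y = c₁ ∧ l₂ y = c₂) := by
    intro y hy
    have hyP := subset_convexHull 𝕜 s hy
    simp only [add_apply, smul_apply, smul_eq_mul]
    obtain heq | hlt := (hl₁ y hyP).eq_or_lt
    · simpa [heq] using hl₂ y ⟨hyP, heq⟩
    · have := hN y ⟨hy, hlt⟩
      exact ⟨by linarith, fun h => by linarith⟩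
  have hle : ∀ y ∈ convexHull 𝕜 s, (N • l₁ + l₂) y ≤ N * c₁ + c₂ :=
    fun y hy => convexHull_min (fun z hz => (hgen z hz).1)
      (convex_halfSpace_le (N • l₁ + l₂).toLinearMap.isLinear _) hy
  have hexp := isExposed_sep_eq_of_forall_le hle
  convert hexp using 1
  refine Set.Subset.antisymm ?_ ?_
  · rintro x ⟨⟨hxP, hlx₁⟩, hlx₂⟩
    exact ⟨hxP, by simp [hlx₁, hlx₂]⟩
  · rw [eq_convexHull_inter_of_isExtreme hexp.isExtreme (hexp.convex (convex_convexHull 𝕜 s))]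
    refine convexHull_min (fun y ⟨hys, hyP, hy⟩ => ?_) hBconv
    obtain ⟨hly₁, hly₂⟩ := (hgen y hys).2 hy
    exact ⟨⟨hyP, hly₁⟩, hly₂⟩

end ConvexHull

section Faces

variable {E : Type*} [NormedAddCommGroup E] [NormedSpace ℝ E] {P F G : Set E}

theorem IsPolytope.convex (hP : IsPolytope P) : Convex ℝ P := by
  obtain ⟨s, -, rfl⟩ := hP
  exact convex_convexHull ℝ _

theorem IsPolytope.self_mem_faces (hP : IsPolytope P) : P ∈ faces P := by
  obtain ⟨s, hs, rfl⟩ := hP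
  exact ⟨convexHull_nonempty_iff.2 hs, IsExposed.refl _⟩

theorem IsPolytope.insert_self_properFaces (hP : IsPolytope P) :
    insert P (properFaces P) = faces P := by
  change insert P (faces P \ {P}) = faces P
  rw [Set.insert_sdiff_singleton, Set.insert_eq_of_mem hP.self_mem_faces]

theorem IsPolytope.of_mem_faces (hP : IsPolytope P) (hF : F ∈ faces P) : IsPolytope F := by
  classical
  have hFconv : Convex ℝ F := hF.2.convex hP.convex
  obtain ⟨s, -, rfl⟩ := hP
  have heq : F = convexHull ℝ (s ∩ F) := eq_convexHull_inter_of_isExtreme hF.2.isExtreme hFconv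
  have hcoe : ((s.filter (· ∈ F) : Finset E) : Set E) = ↑s ∩ F := by
    ext
    simp only [Finset.coe_filter, Set.mem_ofPred_eq, Set.mem_inter_iff, Finset.mem_coe]
  refine ⟨s.filter (· ∈ F), ?_, hcoe ▸ heq⟩
  rw [← Finset.coe_nonempty, hcoe, ← convexHull_nonempty_iff (𝕜 := ℝ), ← heq]
  exact hF.1

theorem mem_faces_of_subset (hF : F ∈ faces P) (hG : G ∈ faces P) (h : G ⊆ F) : G ∈ faces F :=
  ⟨hG.1, hG.2.mono hF.2.subset h⟩

theorem inter_mem_faces (hF : F ∈ faces P) (hG : G ∈ faces P) (h : (F ∩ G).Nonempty) :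
    F ∩ G ∈ faces P :=
  ⟨h, hF.2.inter hG.2⟩

theorem IsPolytope.faces_subset (hP : IsPolytope P) (hF : F ∈ faces P) : faces F ⊆ faces P := by
  obtain ⟨s, -, rfl⟩ := hP
  exact fun G hG => ⟨hG.1, isExposed_trans_of_finite s.finite_toSet hF.2 hG.2⟩

/-- The relative interior of a polytope `P`, encoded as the set of points of `P` that lie in no
proper face. -/
def openFace (P : Set E) : Set E :=
  P \ boundary P

theorem subset_of_mem_openFace (hF : F ∈ faces P) (hG : G ∈ faces P) {y : E}
    (hyF : y ∈ openFace F) (hyG : y ∈ G) : F ⊆ G := by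
  have hFG : F ∩ G ∈ faces F := mem_faces_of_subset hF (inter_mem_faces hF hG ⟨y, hyF.1, hyG⟩)
    Set.inter_subset_left
  by_contra hsub
  exact hyF.2 ⟨hyF.1, F ∩ G, ⟨hFG, mt Set.inter_eq_left.1 hsub⟩, hyF.1, hyG⟩

theorem pairwiseDisjoint_openFace (P : Set E) : (faces P).PairwiseDisjoint openFace := by
  refine fun F hF G hG hne => Set.disjoint_left.2 fun y hyF hyG => hne ?_
  exact (subset_of_mem_openFace hF hG hyF hyG.1).antisymm
    (subset_of_mem_openFace hG hF hyG hyF.1)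

theorem IsPolytope.exists_mem_openFace (hP : IsPolytope P) {y : E} (hy : y ∈ P) :
    ∃ F ∈ faces P, y ∈ openFace F := by
  have hfin : {F ∈ faces P | y ∈ F}.Finite := hP.finite_faces.subset (Set.sep_subset _ _)
  obtain ⟨F, ⟨hF, hyF⟩, hmin⟩ := hfin.exists_minimal ⟨P, hP.self_mem_faces, hy⟩
  refine ⟨F, hF, hyF, ?_⟩
  rintro ⟨-, G, ⟨hG, hne⟩, hyG⟩
  exact hne (hG.2.subset.antisymm (hmin ⟨hP.faces_subset hF hG, hyG⟩ hG.2.subset))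

theorem convexHull_range_subset_boundary_iff (hP : Convex ℝ P) {ι : Type*} [Fintype ι]
    {w : ι → ℝ} (hw₀ : ∀ i, 0 < w i) (hw₁ : ∑ i, w i = 1) {x : ι → E} (hx : ∀ i, x i ∈ P) :
    convexHull ℝ (Set.range x) ⊆ boundary P ↔ ∑ i, w i • x i ∈ boundary P := by
  constructor
  · exact fun h => h (mem_convexHull_of_exists_fintype w x (fun i => (hw₀ i).le) hw₁
      Set.mem_range_self rfl)
  · rintro ⟨-, F, hF, hsum⟩
    have hsub : convexHull ℝ (Set.range x) ⊆ F :=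
      convexHull_min (Set.range_subset_iff.2 ((sum_smul_mem_iff hP hF.1.2 hw₀ hw₁ hx).1 hsum))
        (hF.1.2.convex hP)
    exact fun y hy => ⟨hF.1.2.subset (hsub hy), F, hF, hsub hy⟩

end Faces

section ChainSums

variable {E : Type*} [NormedAddCommGroup E] [NormedSpace ℝ E] {P F G : Set E} {v : Set E → E}
  {k : ℕ} {x : E}

/-- A choice of a point `v F` in every face `F` of `P`, not necessarily a vertex, such that `v F` is
also the point chosen in each face of `F` that contains it. Applied to the face `F₁ ∩ F₂` of `F₁`
and of `F₂`, the second field gives the consistency condition of `IsApexAssignment`. -/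
structure IsFaceSelection (P : Set E) (v : Set E → E) : Prop where
  mem : ∀ F ∈ faces P, v F ∈ F
  eq_of_subset_of_mem : ∀ F ∈ faces P, ∀ G ∈ faces P, G ⊆ F → v F ∈ G → v G = v F

theorem IsApexAssignment.isFaceSelection (hv : IsApexAssignment P v) : IsFaceSelection P v where
  mem F hF := (hv.vertex F hF).1
  eq_of_subset_of_mem F hF G hG hGF h :=
    hv.consistent G hG F hF ⟨(hv.vertex G hG).1, hGF (hv.vertex G hG).1⟩ ⟨h, (hv.vertex F hF).1⟩

theorem IsFaceSelection.of_mem_faces (hv : IsFaceSelection P v) (hP : IsPolytope P)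
    (hF : F ∈ faces P) : IsFaceSelection F v where
  mem G hG := hv.mem G (hP.faces_subset hF hG)
  eq_of_subset_of_mem G hG H hH :=
    hv.eq_of_subset_of_mem G (hP.faces_subset hF hG) H (hP.faces_subset hF hH)

theorem IsFaceSelection.apply_inter (hv : IsFaceSelection P v) (hG : G ∈ faces P)
    (hF : F ∈ faces P) (h : v G ∈ F) : v (G ∩ F) = v G :=
  hv.eq_of_subset_of_mem G hG _ (inter_mem_faces hG hF ⟨v G, hv.mem G hG, h⟩)
    Set.inter_subset_left ⟨hv.mem G hG, h⟩

theorem IsPolytope.finite_chainSums (hP : IsPolytope P) (v : Set E → E) (k : ℕ) :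
    (chainSums v P k).Finite := by
  have := hP.finite_faces.to_subtype
  refine (Set.finite_range fun F : Fin k → faces P => ∑ i, v (F i)).subset ?_
  rintro x ⟨F, hF, -, rfl⟩
  exact ⟨fun i => ⟨F i, hF i⟩, rfl⟩

theorem interiorChainSums_subset_chainSums (v : Set E → E) (P : Set E) (k : ℕ) :
    interiorChainSums v P k ⊆ chainSums v P k := by
  rintro x ⟨G, hG, hanti, -, rfl⟩
  exact ⟨G, hG, hanti, rfl⟩

theorem sum_fin_inv_natCast {K : Type*} [DivisionRing K] [CharZero K] (hk : k ≠ 0) :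
    ∑ _i : Fin k, (k : K)⁻¹ = 1 := by
  simp [hk]

theorem inv_smul_sum_mem_iff (hP : Convex ℝ P) (hF : F ∈ faces P) (hk : k ≠ 0) {y : Fin k → E}
    (hy : ∀ i, y i ∈ P) : (k : ℝ)⁻¹ • ∑ i, y i ∈ F ↔ ∀ i, y i ∈ F := by
  rw [Finset.smul_sum]
  exact sum_smul_mem_iff hP hF.2 (fun _ => by positivity) (sum_fin_inv_natCast hk) hy

theorem IsFaceSelection.mem_interiorChainSums_iff (hv : IsFaceSelection P v) (hP : IsPolytope P)
    (hk : k ≠ 0) :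
    x ∈ interiorChainSums v P k ↔ x ∈ chainSums v P k ∧ (k : ℝ)⁻¹ • x ∈ openFace P := by
  have key (G : Fin k → Set E) (hG : ∀ i, G i ∈ faces P) :
      ¬ convexHull ℝ (Set.range fun i => v (G i)) ⊆ boundary P ↔
        (k : ℝ)⁻¹ • ∑ i, v (G i) ∈ openFace P := by
    have hmem : ∀ i, v (G i) ∈ P := fun i => (hG i).2.subset (hv.mem _ (hG i))
    have hmean := (inv_smul_sum_mem_iff hP.convex hP.self_mem_faces hk hmem).2 hmem
    rw [openFace, Set.mem_sdiff, and_iff_right hmean, Finset.smul_sum,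
      convexHull_range_subset_boundary_iff hP.convex (fun _ => by positivity)
      (sum_fin_inv_natCast hk) hmem]
  constructor
  · rintro ⟨G, hG, hanti, hint, rfl⟩
    exact ⟨⟨G, hG, hanti, rfl⟩, (key G hG).1 hint⟩
  · rintro ⟨⟨G, hG, hanti, rfl⟩, hint⟩
    exact ⟨G, hG, hanti, (key G hG).2 hint, rfl⟩

theorem IsFaceSelection.mem_chainSums_face_iff (hv : IsFaceSelection P v) (hP : IsPolytope P)
    (hF : F ∈ faces P) (hk : k ≠ 0) :
    x ∈ chainSums v F k ↔ x ∈ chainSums v P k ∧ (k : ℝ)⁻¹ • x ∈ F := by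
  have hmean (G : Fin k → Set E) (hG : ∀ i, G i ∈ faces P) :
      (k : ℝ)⁻¹ • ∑ i, v (G i) ∈ F ↔ ∀ i, v (G i) ∈ F :=
    inv_smul_sum_mem_iff hP.convex hF hk fun i => (hG i).2.subset (hv.mem _ (hG i))
  constructor
  · rintro ⟨G, hG, hanti, rfl⟩
    have hGP : ∀ i, G i ∈ faces P := fun i => hP.faces_subset hF (hG i)
    exact ⟨⟨G, hGP, hanti, rfl⟩,
      (hmean G hGP).2 fun i => (hG i).2.subset (hv.mem _ (hGP i))⟩
  · rintro ⟨⟨G, hG, hanti, rfl⟩, hx⟩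
    have hvF : ∀ i, v (G i) ∈ F := (hmean G hG).1 hx
    refine ⟨fun i => G i ∩ F, fun i => ?_, fun i j hij =>
      Set.inter_subset_inter_left _ (hanti hij), ?_⟩
    · exact mem_faces_of_subset hF (inter_mem_faces (hG i) hF ⟨_, hv.mem _ (hG i), hvF i⟩)
        Set.inter_subset_right
    · exact Finset.sum_congr rfl fun i _ => (hv.apply_inter (hG i) hF (hvF i)).symm

theorem IsFaceSelection.mem_interiorChainSums_face_iff (hv : IsFaceSelection P v)
    (hP : IsPolytope P) (hF : F ∈ faces P) (hk : k ≠ 0) :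
    x ∈ interiorChainSums v F k ↔ x ∈ chainSums v P k ∧ (k : ℝ)⁻¹ • x ∈ openFace F := by
  rw [(hv.of_mem_faces hP hF).mem_interiorChainSums_iff (hP.of_mem_faces hF) hk,
    hv.mem_chainSums_face_iff hP hF hk, and_assoc,
    and_iff_right_of_imp fun h : (k : ℝ)⁻¹ • x ∈ openFace F => h.1]

theorem IsFaceSelection.pairwiseDisjoint_interiorChainSums (hv : IsFaceSelection P v)
    (hP : IsPolytope P) (hk : k ≠ 0) :
    (faces P).PairwiseDisjoint fun F => interiorChainSums v F k := by
  refine fun F hF G hG hne => Set.disjoint_left.2 fun x hxF hxG => ?_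
  exact Set.disjoint_left.1 (pairwiseDisjoint_openFace P hF hG hne)
    ((hv.mem_interiorChainSums_face_iff hP hF hk).1 hxF).2
    ((hv.mem_interiorChainSums_face_iff hP hG hk).1 hxG).2

theorem IsFaceSelection.biUnion_interiorChainSums (hv : IsFaceSelection P v) (hP : IsPolytope P)
    (hk : k ≠ 0) : ⋃ F ∈ faces P, interiorChainSums v F k = chainSums v P k := by
  ext x
  simp only [Set.mem_iUnion, exists_prop]
  constructor
  · rintro ⟨F, hF, hx⟩
    exact ((hv.mem_interiorChainSums_face_iff hP hF hk).1 hx).1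
  · intro hx
    have hxP := ((hv.mem_chainSums_face_iff hP hP.self_mem_faces hk).1 hx).2
    obtain ⟨F, hF, hxF⟩ := hP.exists_mem_openFace hxP
    exact ⟨F, hF, (hv.mem_interiorChainSums_face_iff hP hF hk).2 ⟨hx, hxF⟩⟩

theorem IsFaceSelection.ncard_biUnion_interiorChainSums (hv : IsFaceSelection P v)
    (hP : IsPolytope P) {S : Set (Set E)} (hS : S ⊆ faces P) (hk : k ≠ 0) :
    (⋃ F ∈ S, interiorChainSums v F k).ncard = ∑ᶠ F ∈ S, (interiorChainSums v F k).ncard :=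
  (hP.finite_faces.subset hS).ncard_biUnion
    (fun F hF => ((hP.of_mem_faces (hS hF)).finite_chainSums v k).subset
      (interiorChainSums_subset_chainSums v F k))
    ((hv.pairwiseDisjoint_interiorChainSums hP hk).subset hS)

theorem IsFaceSelection.ncard_chainSums_eq (hv : IsFaceSelection P v) (hP : IsPolytope P)
    (hk : k ≠ 0) :
    (chainSums v P k).ncard = (interiorChainSums v P k).ncard +
      ∑ᶠ F ∈ properFaces P, (interiorChainSums v F k).ncard := by
  rw [← hv.biUnion_interiorChainSums hP hk, hv.ncard_biUnion_interiorChainSums hP subset_rfl hk,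
    ← hP.insert_self_properFaces, finsum_mem_insert _ (fun h => h.2 rfl)
      (hP.finite_faces.subset fun F hF => hF.1)]

theorem antitone_cons {α : Type*} [Preorder α] {a : α} {f : Fin k → α} (hf : Antitone f)
    (ha : ∀ i, f i ≤ a) : Antitone (Fin.cons a f : Fin (k + 1) → α) := by
  simp only [Antitone, Fin.forall_fin_succ, Fin.cons_zero, Fin.cons_succ]
  exact ⟨⟨fun _ => le_rfl, fun i _ => ha i⟩,
    fun i => ⟨fun h => absurd h (Fin.succ_pos i).not_ge, fun j h => hf (Fin.succ_le_succ_iff.1 h)⟩⟩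

theorem add_mem_chainSums_succ (hP : P ∈ faces P) (hx : x ∈ chainSums v P k) :
    v P + x ∈ chainSums v P (k + 1) := by
  obtain ⟨G, hG, hanti, rfl⟩ := hx
  refine ⟨Fin.cons P G, Fin.cases hP hG, antitone_cons hanti fun i => (hG i).2.subset, ?_⟩
  simp only [Fin.sum_univ_succ, Fin.cons_zero, Fin.cons_succ]

theorem IsFaceSelection.mem_image_add_chainSums_iff (hv : IsFaceSelection P v) (hP : IsPolytope P)
    (hF : F ∈ faces P) (hx : x ∈ interiorChainSums v F (k + 1)) :
    x ∈ (v P + ·) '' chainSums v P k ↔ v P ∈ F := by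
  obtain ⟨hxP, hxF⟩ := (hv.mem_interiorChainSums_face_iff hP hF k.succ_ne_zero).1 hx
  have hmean (G : Fin (k + 1) → Set E) (hG : ∀ i, G i ∈ faces P) {H : Set E} (hH : H ∈ faces P) :
      ((k + 1 : ℕ) : ℝ)⁻¹ • ∑ i, v (G i) ∈ H ↔ ∀ i, v (G i) ∈ H :=
    inv_smul_sum_mem_iff hP.convex hH k.succ_ne_zero fun i => (hG i).2.subset (hv.mem _ (hG i))
  constructor
  · rintro ⟨y, ⟨G, hG, -, rfl⟩, rfl⟩
    have := (hmean (Fin.cons P G) (Fin.cases hP.self_mem_faces hG) hF).1 (by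
      simpa [Fin.sum_univ_succ] using hxF.1)
    exact this 0
  · intro hvF
    obtain ⟨G, hG, hanti, rfl⟩ := hxP
    have hG0 := (hmean G hG (hG 0)).2 fun i => hanti (Fin.zero_le i) (hv.mem _ (hG i))
    have hFG : F ⊆ G 0 := subset_of_mem_openFace hF (hG 0) hxF hG0
    refine ⟨∑ i : Fin k, v (G i.succ), ⟨fun i => G i.succ, fun i => hG _,
      hanti.comp_monotone Fin.strictMono_succ.monotone, rfl⟩, ?_⟩
    rw [Fin.sum_univ_succ, hv.eq_of_subset_of_mem P hP.self_mem_faces _ (hG 0) (hG 0).2.subset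
      (hFG hvF)]

theorem IsFaceSelection.chainSums_succ_sdiff_image (hv : IsFaceSelection P v) (hP : IsPolytope P)
    (k : ℕ) :
    chainSums v P (k + 1) \ (v P + ·) '' chainSums v P k =
      ⋃ F ∈ {F ∈ faces P | v P ∉ F}, interiorChainSums v F (k + 1) := by
  ext x
  simp only [← hv.biUnion_interiorChainSums hP k.succ_ne_zero, Set.mem_sdiff, Set.mem_iUnion,
    Set.mem_ofPred_eq, exists_prop]
  constructor
  · rintro ⟨⟨F, hF, hxF⟩, hx⟩
    exact ⟨F, ⟨hF, mt (hv.mem_image_add_chainSums_iff hP hF hxF).2 hx⟩, hxF⟩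
  · rintro ⟨F, ⟨hF, hvF⟩, hxF⟩
    exact ⟨⟨F, hF, hxF⟩, mt (hv.mem_image_add_chainSums_iff hP hF hxF).1 hvF⟩

theorem IsFaceSelection.ncard_chainSums_succ (hv : IsFaceSelection P v) (hP : IsPolytope P)
    (k : ℕ) :
    (chainSums v P (k + 1)).ncard = (chainSums v P k).ncard +
      ∑ᶠ F ∈ {F ∈ faces P | v P ∉ F}, (interiorChainSums v F (k + 1)).ncard := by
  have himage : (v P + ·) '' chainSums v P k ⊆ chainSums v P (k + 1) :=
    Set.image_subset_iff.2 fun x hx => add_mem_chainSums_succ hP.self_mem_faces hx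
  rw [← Set.ncard_sdiff_add_ncard_of_subset himage (hP.finite_chainSums v _),
    Set.ncard_image_of_injective _ (add_right_injective (v P)), add_comm,
    hv.chainSums_succ_sdiff_image hP,
    hv.ncard_biUnion_interiorChainSums hP (Set.sep_subset _ _) k.succ_ne_zero]

theorem IsPolytope.chainSums_zero (hP : IsPolytope P) (v : Set E → E) : chainSums v P 0 = {0} := by
  refine Set.eq_singleton_iff_unique_mem.2 ⟨⟨fun _ => P, fun _ => hP.self_mem_faces,
    antitone_const, (Fin.sum_univ_zero _).symm⟩, ?_⟩
  rintro x ⟨G, -, -, rfl⟩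
  exact Fin.sum_univ_zero _

end ChainSums

section Recursion

variable {E : Type*} [NormedAddCommGroup E] [NormedSpace ℝ E] [FiniteDimensional ℝ E]
  {P : Set E} {v : Set E → E}

theorem properFaces_eq_empty_of_dim_eq_zero (h : dim P = 0) : properFaces P = ∅ :=
  Set.eq_empty_of_forall_notMem fun _ hF => Nat.not_lt_zero _ (h ▸ dim_lt_of_mem_properFaces hF)

theorem polytopeNumber_zero (v : Set E → E) (P : Set E) : polytopeNumber v P 0 = 0 := by
  rw [polytopeNumber]

theorem polytopeNumber_one (v : Set E → E) (P : Set E) : polytopeNumber v P 1 = 1 := by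
  rw [polytopeNumber]

theorem interiorPolytopeNumber_zero (v : Set E → E) (P : Set E) :
    interiorPolytopeNumber v P 0 = 0 := by
  rw [interiorPolytopeNumber]

theorem interiorPolytopeNumber_one (v : Set E → E) (P : Set E) :
    interiorPolytopeNumber v P 1 = if dim P = 0 then 1 else 0 := by
  rw [interiorPolytopeNumber]

theorem polytopeNumber_succ_of_dim_eq_zero (h : dim P = 0) (n : ℕ) :
    polytopeNumber v P (n + 1) = 1 := by
  cases n with
  | zero => exact polytopeNumber_one v P
  | succ n => rw [polytopeNumber, if_pos h]

theorem polytopeNumber_add_two (hvP : v P ∈ P) (n : ℕ) :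
    polytopeNumber v P (n + 2) = polytopeNumber v P (n + 1) +
      ∑ᶠ F ∈ {F ∈ faces P | v P ∉ F}, interiorPolytopeNumber v F (n + 2) := by
  have hset : {F ∈ faces P | v P ∉ F} = {F | F ∈ properFaces P ∧ v P ∉ F} :=
    Set.ext fun F => ⟨fun h => ⟨⟨h.1, fun hFP => h.2 (hFP ▸ hvP)⟩, h.2⟩, fun h => ⟨h.1.1, h.2⟩⟩
  rw [hset]
  by_cases h : dim P = 0
  · simp [polytopeNumber_succ_of_dim_eq_zero h, properFaces_eq_empty_of_dim_eq_zero h]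
  · rw [polytopeNumber, if_neg h]
    exact congrArg _ (finsum_set_coe_eq_finsum_mem (f := (interiorPolytopeNumber v · (n + 2))) _)

theorem interiorPolytopeNumber_add_two (v : Set E → E) (P : Set E) (n : ℕ) :
    interiorPolytopeNumber v P (n + 2) = polytopeNumber v P (n + 2) -
      ∑ᶠ F ∈ properFaces P, interiorPolytopeNumber v F (n + 2) := by
  rw [interiorPolytopeNumber]
  by_cases h : dim P = 0
  · simp [h, polytopeNumber_succ_of_dim_eq_zero h, properFaces_eq_empty_of_dim_eq_zero h]
  · rw [if_neg h]
    exact congrArg _ (finsum_set_coe_eq_finsum_mem (f := (interiorPolytopeNumber v · (n + 2))) _)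

theorem IsFaceSelection.polytopeNumber_succ_eq_ncard_of_properFaces (hv : IsFaceSelection P v)
    (hP : IsPolytope P)
    (h : ∀ F ∈ properFaces P, ∀ k,
      interiorPolytopeNumber v F (k + 2) = (interiorChainSums v F (k + 1)).ncard) (k : ℕ) :
    polytopeNumber v P (k + 1) = (chainSums v P k).ncard := by
  induction k with
  | zero => rw [polytopeNumber_one, hP.chainSums_zero, Set.ncard_singleton, Nat.cast_one]
  | succ k ih =>
    have hvP : v P ∈ P := hv.mem P hP.self_mem_faces
    rw [polytopeNumber_add_two hvP, ih, hv.ncard_chainSums_succ hP, Nat.cast_add,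
      Nat.cast_finsum_mem (hP.finite_faces.subset (Set.sep_subset _ _))]
    congr 1
    exact finsum_mem_congr rfl fun F hF => h F ⟨hF.1, fun hFP => hF.2 (hFP ▸ hvP)⟩ k

theorem IsFaceSelection.interiorPolytopeNumber_eq_ncard (hv : IsFaceSelection P v)
    (hP : IsPolytope P) (k : ℕ) :
    interiorPolytopeNumber v P (k + 2) = (interiorChainSums v P (k + 1)).ncard := by
  induction hd : dim P using Nat.strong_induction_on generalizing P k with
  | _ d ih =>
    have hproper : ∀ F ∈ properFaces P, ∀ k,
        interiorPolytopeNumber v F (k + 2) = (interiorChainSums v F (k + 1)).ncard :=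
      fun F hF k => ih _ (hd ▸ dim_lt_of_mem_properFaces hF) (hv.of_mem_faces hP hF.1)
        (hP.of_mem_faces hF.1) k rfl
    rw [interiorPolytopeNumber_add_two, finsum_mem_congr rfl fun F hF => hproper F hF k,
      hv.polytopeNumber_succ_eq_ncard_of_properFaces hP hproper,
      hv.ncard_chainSums_eq hP k.succ_ne_zero, Nat.cast_add,
      Nat.cast_finsum_mem (hP.finite_faces.subset fun F hF => hF.1), add_sub_cancel_right]

theorem IsFaceSelection.polytopeNumber_eq_ncard (hv : IsFaceSelection P v) (hP : IsPolytope P)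
    (k : ℕ) : polytopeNumber v P (k + 1) = (chainSums v P k).ncard :=
  hv.polytopeNumber_succ_eq_ncard_of_properFaces hP
    (fun _ hF => (hv.of_mem_faces hP hF.1).interiorPolytopeNumber_eq_ncard
      (hP.of_mem_faces hF.1)) k

end Recursion

end PolytopeNumbers

theorem mainTheorem5_general {E : Type*} [NormedAddCommGroup E] [NormedSpace ℝ E]
    [FiniteDimensional ℝ E] {P : Set E} (hP : PolytopeNumbers.IsPolytope P) {v : Set E → E}
    (hv : PolytopeNumbers.IsFaceSelection P v) :
    PolytopeNumbers.polytopeNumber v P 0 = 0 ∧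
    PolytopeNumbers.interiorPolytopeNumber v P 0 = 0 ∧
    PolytopeNumbers.polytopeNumber v P 1 = 1 ∧
    PolytopeNumbers.interiorPolytopeNumber v P 1 =
      (if PolytopeNumbers.dim P = 0 then 1 else 0) ∧
    ∀ n : ℕ, 2 ≤ n →
      (PolytopeNumbers.chainSums v P (n - 1)).Finite ∧
      PolytopeNumbers.polytopeNumber v P n =
        ((PolytopeNumbers.chainSums v P (n - 1)).ncard : ℤ) ∧
      PolytopeNumbers.interiorPolytopeNumber v P n =
        ((PolytopeNumbers.interiorChainSums v P (n - 1)).ncard : ℤ) := by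
  open PolytopeNumbers in
  refine ⟨polytopeNumber_zero v P, interiorPolytopeNumber_zero v P, polytopeNumber_one v P,
    interiorPolytopeNumber_one v P, fun n hn => ?_⟩
  obtain ⟨k, rfl⟩ := Nat.exists_eq_add_of_le' hn
  exact ⟨hP.finite_chainSums v (k + 1), hv.polytopeNumber_eq_ncard hP (k + 1),
    hv.interiorPolytopeNumber_eq_ncard hP k⟩

theorem mainTheorem5 (m : ℕ) (P : Set (EuclideanSpace ℝ (Fin m)))
    (hP : PolytopeNumbers.IsPolytope P)
    (v : Set (EuclideanSpace ℝ (Fin m)) → EuclideanSpace ℝ (Fin m))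
    (hv : PolytopeNumbers.IsApexAssignment P v) :
    PolytopeNumbers.polytopeNumber v P 0 = 0 ∧
    PolytopeNumbers.interiorPolytopeNumber v P 0 = 0 ∧
    PolytopeNumbers.polytopeNumber v P 1 = 1 ∧
    PolytopeNumbers.interiorPolytopeNumber v P 1 =
      (if PolytopeNumbers.dim P = 0 then 1 else 0) ∧
    ∀ n : ℕ, 2 ≤ n →
      (PolytopeNumbers.chainSums v P (n - 1)).Finite ∧
      PolytopeNumbers.polytopeNumber v P n =
        ((PolytopeNumbers.chainSums v P (n - 1)).ncard : ℤ) ∧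
      PolytopeNumbers.interiorPolytopeNumber v P n =
        ((PolytopeNumbers.interiorChainSums v P (n - 1)).ncard : ℤ) :=
  mainTheorem5_general hP hv.isFaceSelection
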